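/- Consider the univariate model $Y_i=\mu^0+\theta^0_{X_i}+\varepsilon_i$, $i=1,\dots,n$ ($n\ge 1$), where $X_1,\dots,X_n\in\{1,\dots,K\}$ are fixed, $\mu^0\in\mathbb R$, and the errors $\varepsilon_1,\dots,\varepsilon_n$ are independent, have mean zero and are sub-Gaussian with parameter $\sigma>0$, i.e. $\mathbb E e^{t\varepsilon_i}\le e^{\sigma^2t^2/2}$ for all $t\in\mathbb R$. Let $n_k=|\{i:X_i=k\}|$, $n_{\min}=\min_k n_k$, and assume $\theta^0\in\Theta=\{\theta\in\mathbb R^K:\sum_{k=1}^K n_k\theta_k=0\}$. Let $s=|\{\theta^0_1,\dots,\theta^0_K\}|$ be the number of distinct true coefficients, let $n^0_{\min}$ and $n^0_{\max}$ be the minimum and the maximum over $k$ of $\sum_{l:\theta^0_l=\theta^0_k}n_l$, and let $\Delta(\theta^0)=\min\{|\theta^0_k-\theta^0_l|:\theta^0_k\ne\theta^0_l\}$, with $\Delta(\theta^0)=\infty$ if all $\theta^0_k$ are equal. Let $\gamma,\lambda>0$, let $\rho(x)=\int_0^x\lambda\,(1-t/(\gamma\lambda))_+\,dt$ be the minimax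 concave penalty, put $\hat\mu=\frac1n\sum_i Y_i$, and let $$Q(\theta)=\frac1{2n}\sum_{i=1}^n(Y_i-\hat\mu-\theta_{X_i})^2+\sum_{k=1}^{K-1}\rho(\theta_{(k+1)}-\theta_{(k)}),$$ where $\theta_{(1)}\le\dots\le\theta_{(K)}$ are the order statistics of $\theta$. The SCOPE estimate $\hat\theta$ is a global minimiser of $Q$ over $\Theta$. The oracle least-squares estimate $\hat\theta^0$ is the minimiser of $\frac1{2n}\sum_i(Y_i-\hat\mu-\theta_{X_i})^2$ over those $\theta\in\Theta$ with $\theta_k=\theta_l$ whenever $\theta^0_k=\theta^0_l$. Suppose that $\eta\in(0,1]$ satisfies $\eta/s\le n^0_{\min}/n\le n^0_{\max}/n\le 1/(\eta s)$. Let $\gamma_*=\min\{\gamma,\eta s\}$ and $\gamma^*=\max\{\gamma,\eta s\}$, and suppose that $$\Delta(\theta^0)\ge 3\left(1+\frac{\sqrt2}{\eta}\right)\sqrt{\gamma\gamma^*}\,\lambda.$$ Then, with probability at least $$1-2\exp\left(-\frac{n_{\min}\,\eta\, s\,\gamma_*\lambda^2}{8\sigma^2}+\log K\right),$$ the oracle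 least-squares estimate $\hat\theta^0$ is the unique global minimiser of $Q$ over $\Theta$, so that $\hat\theta=\hat\theta^0$. -/

import Mathlib

open MeasureTheory ProbabilityTheory
open scoped NNReal

namespace SCOPE

noncomputable section

/-- The responses of the one-predictor model: `Y i = μ0 + θ0 (X i) + ε i`, where `X i` is the level
of the categorical predictor for the `i`th observation. -/
def response {n K : ℕ} (X : Fin n → Fin K) (mu0 : ℝ) (theta0 : Fin K → ℝ) (e : Fin n → ℝ) :
    Fin n → ℝ :=
  fun i => mu0 + theta0 (X i) + e i

/-- The number of observations with level `k`. -/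
def levelCount {n K : ℕ} (X : Fin n → Fin K) (k : Fin K) : ℕ :=
  (Finset.univ.filter fun i => X i = k).card

/-- The smallest number of observations of a level. -/
def minLevelCount {n K : ℕ} (X : Fin n → Fin K) : ℕ :=
  ⨅ k, levelCount X k

/-- The number of observations whose level has the same true coefficient as level `k`. -/
def fusedCount {n K : ℕ} (X : Fin n → Fin K) (theta0 : Fin K → ℝ) (k : Fin K) : ℕ :=
  ∑ l ∈ Finset.univ.filter (fun l => theta0 l = theta0 k), levelCount X l

/-- The smallest number of observations of a group of fused levels. -/
def minFusedCount {n K : ℕ} (X : Fin n → Fin K) (theta0 : Fin K → ℝ) : ℕ :=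
  ⨅ k, fusedCount X theta0 k

/-- The largest number of observations of a group of fused levels. -/
def maxFusedCount {n K : ℕ} (X : Fin n → Fin K) (theta0 : Fin K → ℝ) : ℕ :=
  ⨆ k, fusedCount X theta0 k

/-- The number of distinct true coefficients. -/
def numGroups {K : ℕ} (theta0 : Fin K → ℝ) : ℕ :=
  (Finset.univ.image theta0).card

/-- The smallest distance between distinct coefficients; it is `⊤` if all coefficients agree. -/
def minGap {K : ℕ} (theta : Fin K → ℝ) : EReal :=
  ⨅ (k : Fin K) (l : Fin K) (_ : theta k ≠ theta l), ((|theta k - theta l| : ℝ) : EReal)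

/-- The coefficient vectors that satisfy the identifiability constraint. -/
def Theta {n K : ℕ} (X : Fin n → Fin K) : Set (Fin K → ℝ) :=
  {theta | ∑ k, (levelCount X k : ℝ) * theta k = 0}

/-- The coefficient vectors of `Theta X` that are constant on the groups of fused levels. -/
def oracleTheta {n K : ℕ} (X : Fin n → Fin K) (theta0 : Fin K → ℝ) : Set (Fin K → ℝ) :=
  {theta | theta ∈ Theta X ∧ ∀ k l, theta0 k = theta0 l → theta k = theta l}

/-- The estimated intercept. -/
def muHat {n : ℕ} (Y : Fin n → ℝ) : ℝ :=
  (∑ i, Y i) / n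

/-- The least squares loss. -/
def loss {n K : ℕ} (X : Fin n → Fin K) (Y : Fin n → ℝ) (theta : Fin K → ℝ) : ℝ :=
  1 / (2 * (n : ℝ)) * ∑ i, (Y i - muHat Y - theta (X i)) ^ 2

/-- The minimax concave penalty. -/
def mcp (gam lam x : ℝ) : ℝ :=
  ∫ t in (0 : ℝ)..x, lam * max (1 - t / (gam * lam)) 0

/-- The order statistics: `orderStat theta k` is the entry of `theta` of rank `k` (counted from 0)
in increasing order. -/
def orderStat {K : ℕ} (theta : Fin K → ℝ) : Fin K → ℝ :=
  theta ∘ Tuple.sort theta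

/-- The sum of the penalties of the differences of consecutive order statistics. -/
def penalty {K : ℕ} (gam lam : ℝ) (theta : Fin K → ℝ) : ℝ :=
  ∑ k : Fin (K - 1),
    mcp gam lam (orderStat theta ⟨k + 1, by omega⟩ - orderStat theta ⟨k, by omega⟩)

/-- The SCOPE objective. -/
def objective {n K : ℕ} (gam lam : ℝ) (X : Fin n → Fin K) (Y : Fin n → ℝ) (theta : Fin K → ℝ) : ℝ :=
  loss X Y theta + penalty gam lam theta

/-- The set of minimisers of `f` over `S`. -/
def argmin {α : Type*} (f : α → ℝ) (S : Set α) : Set α :=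
  {x | x ∈ S ∧ ∀ y ∈ S, f x ≤ f y}

/-- The oracle least squares estimates. -/
def oracleLSE {n K : ℕ} (X : Fin n → Fin K) (theta0 : Fin K → ℝ) (Y : Fin n → ℝ) :
    Set (Fin K → ℝ) :=
  argmin (loss X Y) (oracleTheta X theta0)

/-- The SCOPE estimates, that is, the global minimisers of the objective. -/
def scopeEstimate {n K : ℕ} (gam lam : ℝ) (X : Fin n → Fin K) (Y : Fin n → ℝ) :
    Set (Fin K → ℝ) :=
  argmin (objective gam lam X Y) (Theta X)

end

end SCOPE

/-! Up to a constant the loss is `∑ k, w k / 2 * (y k - θ k) ^ 2`, with `w` the level proportions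
and `y` the centred level means. On the event that every level's average error is at most `t`, the
vector of group means is shown to beat every other vector, inside `Theta` or not; it lies in
`Theta`, so the constraint plays no further role. A sub-Gaussian union bound controls the event.

The MCP is nondecreasing and subadditive, so the penalty accumulated along the order statistics is a
potential `ψ` on the levels whose increments dominate `mcp` of the differences (`exists_potential`).
Hence restricting to a subset of the values never raises the penalty, and one may assume that each
`θ k` is the entry of `θ` nearest to `y k` (`exists_nearest`).

For such `θ`, call a group good if some entry is within `r` of the group's centre. Nearness then
brings all its entries within `r + 2t`, and the gap hypothesis separates the good groups by at least
`γλ`, so each pays `mcp` of its own range plus a full jump `γλ²/2` (`sum_mcp_le_penalty`). In a good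
group, splitting reduces the loss by less than the penalty on its range (`eq_or_sum_sq_lt_add_mcp`);
in a bad one the loss alone exceeds what the group mean costs (`le_sum_sq_of_far`). Summing over
groups gives `groupMean_lt_of_nearest`. -/

namespace SCOPE

/-! ### The minimax concave penalty -/

/-- Writing the integral through a truncated square covers both the quadratic and the flat regime.
-/
theorem mcp_eq {gam lam : ℝ} (hgam : 0 < gam) (hlam : 0 < lam) (x : ℝ) :
    mcp gam lam x = gam * lam ^ 2 / 2 - max (gam * lam - x) 0 ^ 2 / (2 * gam) := by
  have hgl : 0 < gam * lam := by positivity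
  have hderiv : ∀ t : ℝ, HasDerivAt (fun x : ℝ => -(max (gam * lam - x) 0 ^ 2 / (2 * gam)))
      (lam * max (1 - t / (gam * lam)) 0) t := by
    intro t
    rcases lt_trichotomy t (gam * lam) with h | h | h
    · have h1 : HasDerivAt (fun x : ℝ => -((gam * lam - x) ^ 2 / (2 * gam)))
          (lam * max (1 - t / (gam * lam)) 0) t := by
        have := ((((hasDerivAt_id t).const_sub (gam * lam)).pow 2).div_const (2 * gam)).neg
        refine this.congr_deriv ?_
        rw [max_eq_left (by rw [sub_nonneg, div_le_one hgl]; exact h.le)]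
        simp only [id]
        field_simp
        ring
      refine h1.congr_of_eventuallyEq ?_
      filter_upwards [eventually_lt_nhds h] with y hy
      rw [max_eq_left (by linarith)]
    -- At the kink the integrand vanishes and the truncated square is of second order.
    · have h1 : lam * max (1 - t / (gam * lam)) 0 = 0 := by
        rw [h, div_self hgl.ne']; simp
      rw [h1, hasDerivAt_iff_isLittleO, h]
      simp only [sub_self, max_self, smul_zero, sub_zero]
      have h2 : (fun x : ℝ => (x - gam * lam) ^ 2) =o[nhds (gam * lam)]
          fun x => x - gam * lam := by
        simpa using Asymptotics.isLittleO_pow_sub_sub (gam * lam) (one_lt_two)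
      refine Asymptotics.IsBigO.trans_isLittleO ?_ h2
      refine Asymptotics.IsBigO.of_bound (1 / (2 * gam)) (Filter.Eventually.of_forall fun y => ?_)
      have h3 : max (gam * lam - y) 0 ^ 2 ≤ (y - gam * lam) ^ 2 := by
        rcases max_cases (gam * lam - y) 0 with ⟨h, _⟩ | ⟨h, _⟩ <;> rw [h] <;>
          nlinarith [sq_nonneg (y - gam * lam)]
      simp only [Real.norm_eq_abs]
      rw [abs_of_nonneg (sq_nonneg (y - gam * lam))]
      norm_num
      rw [abs_of_nonneg (by positivity), div_le_iff₀ (by positivity)]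
      have h4 : gam⁻¹ * (1 / 2) * (y - gam * lam) ^ 2 * (2 * gam) = (y - gam * lam) ^ 2 := by
        field_simp
      linarith
    · have h1 : lam * max (1 - t / (gam * lam)) 0 = 0 := by
        rw [max_eq_right (by rw [sub_nonpos, one_le_div hgl]; exact h.le), mul_zero]
      rw [h1]
      refine (hasDerivAt_const t (0 : ℝ)).congr_of_eventuallyEq ?_
      filter_upwards [eventually_gt_nhds h] with y hy
      rw [max_eq_right (by linarith)]
      simp
  have hcont : Continuous fun t : ℝ => lam * max (1 - t / (gam * lam)) 0 := by fun_prop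
  rw [mcp, intervalIntegral.integral_eq_sub_of_hasDerivAt (fun t _ => hderiv t)
    (hcont.intervalIntegrable _ _), sub_zero, max_eq_left hgl.le]
  field_simp
  ring

theorem mcp_zero (gam lam : ℝ) : mcp gam lam 0 = 0 := by simp [mcp]

theorem mcp_le {gam lam : ℝ} (hgam : 0 < gam) (hlam : 0 < lam) (x : ℝ) :
    mcp gam lam x ≤ gam * lam ^ 2 / 2 := by
  rw [mcp_eq hgam hlam]
  have : 0 ≤ max (gam * lam - x) 0 ^ 2 / (2 * gam) := by positivity
  linarith

theorem mcp_of_le {gam lam : ℝ} (hgam : 0 < gam) (hlam : 0 < lam) {x : ℝ} (hx : gam * lam ≤ x) :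
    mcp gam lam x = gam * lam ^ 2 / 2 := by
  rw [mcp_eq hgam hlam, max_eq_right (by linarith)]
  simp

theorem mcp_of_ge {gam lam : ℝ} (hgam : 0 < gam) (hlam : 0 < lam) {x : ℝ} (hx : x ≤ gam * lam) :
    mcp gam lam x = lam * x - x ^ 2 / (2 * gam) := by
  rw [mcp_eq hgam hlam, max_eq_left (by linarith)]
  field_simp
  ring

/-- By concavity the penalty lies above its chord on `[0, γλ]`, whose slope is `λ/2`. -/
theorem half_mul_lt_mcp {gam lam : ℝ} (hgam : 0 < gam) (hlam : 0 < lam) {x : ℝ} (hx0 : 0 < x)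
    (hx : x < gam * lam) : lam * x / 2 < mcp gam lam x := by
  rw [mcp_of_ge hgam hlam hx.le]
  have : x ^ 2 / (2 * gam) < lam * x / 2 := by
    rw [div_lt_iff₀ (by positivity)]
    nlinarith
  linarith

theorem mcp_mono {gam lam : ℝ} (hgam : 0 < gam) (hlam : 0 < lam) : Monotone (mcp gam lam) := by
  intro x y hxy
  rw [mcp_eq hgam hlam, mcp_eq hgam hlam]
  gcongr

theorem mcp_nonneg {gam lam : ℝ} (hgam : 0 < gam) (hlam : 0 < lam) {x : ℝ} (hx : 0 ≤ x) :
    0 ≤ mcp gam lam x :=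
  (mcp_zero gam lam).symm.le.trans (mcp_mono hgam hlam hx)

/-- A concave function vanishing at zero is subadditive; once one argument reaches `γλ`, its term is
already the maximum. -/
theorem mcp_add_le {gam lam : ℝ} (hgam : 0 < gam) (hlam : 0 < lam) {x y : ℝ} (hx : 0 ≤ x)
    (hy : 0 ≤ y) : mcp gam lam (x + y) ≤ mcp gam lam x + mcp gam lam y := by
  rcases le_total (gam * lam) x with h | h
  · rw [mcp_of_le hgam hlam h]
    linarith [mcp_le hgam hlam (x + y), mcp_nonneg hgam hlam hy]
  rcases le_total (gam * lam) y with h' | h'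
  · rw [mcp_of_le hgam hlam h']
    linarith [mcp_le hgam hlam (x + y), mcp_nonneg hgam hlam hx]
  rw [mcp_eq hgam hlam (x + y), mcp_of_ge hgam hlam h, mcp_of_ge hgam hlam h']
  have key : gam * lam ^ 2 / 2 - (lam * x - x ^ 2 / (2 * gam) + (lam * y - y ^ 2 / (2 * gam)))
      ≤ max (gam * lam - (x + y)) 0 ^ 2 / (2 * gam) := by
    rw [le_div_iff₀ (by positivity)]
    have e : (gam * lam ^ 2 / 2 - (lam * x - x ^ 2 / (2 * gam) + (lam * y - y ^ 2 / (2 * gam))))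
      * (2 * gam) = (gam * lam) ^ 2 - 2 * (gam * lam) * x + x ^ 2 - 2 * (gam * lam) * y + y ^ 2 := by
      field_simp
      ring
    rw [e]
    generalize gam * lam = a at *
    rcases max_cases (a - (x + y)) 0 with ⟨h1, h2⟩ | ⟨h1, h2⟩ <;> rw [h1] <;> nlinarith
  linarith

/-! ### The penalty as a potential along the order statistics -/

/-- The order statistics as a sequence, constant from the largest one on. -/
theorem exists_monotone_seq {K : ℕ} (hK : 0 < K) (gam lam : ℝ) (theta : Fin K → ℝ) :
    ∃ F : ℕ → ℝ, Monotone F ∧ (∀ k : Fin K, F ((Tuple.sort theta).symm k) = theta k) ∧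
      (∀ k : Fin K, F k ∈ Set.range theta) ∧
      penalty gam lam theta = ∑ m ∈ Finset.range (K - 1), mcp gam lam (F (m + 1) - F m) := by
  refine ⟨fun m => orderStat theta ⟨min m (K - 1), by omega⟩, ?_, ?_, ?_, ?_⟩
  · intro a b hab
    exact Tuple.monotone_sort theta (by simp only [Fin.mk_le_mk]; omega)
  · intro k
    have : (⟨min ((Tuple.sort theta).symm k : ℕ) (K - 1), by omega⟩ : Fin K)
        = (Tuple.sort theta).symm k := by
      ext
      simp only
      omega
    simp [this, orderStat]
  · intro k
    exact ⟨_, rfl⟩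
  · rw [penalty, ← Fin.sum_univ_eq_sum_range
      (fun m => mcp gam lam (orderStat theta ⟨min (m + 1) (K - 1), by omega⟩
        - orderStat theta ⟨min m (K - 1), by omega⟩))]
    refine Finset.sum_congr rfl fun k _ => ?_
    have h1 : min ((k : ℕ) + 1) (K - 1) = k + 1 := by omega
    have h2 : min (k : ℕ) (K - 1) = k := by omega
    simp only [h1, h2]

theorem mcp_sub_le_sum {gam lam : ℝ} (hgam : 0 < gam) (hlam : 0 < lam) {F : ℕ → ℝ}
    (hF : Monotone F) {a b : ℕ} (hab : a ≤ b) :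
    mcp gam lam (F b - F a) ≤ ∑ m ∈ Finset.Ico a b, mcp gam lam (F (m + 1) - F m) := by
  induction b, hab using Nat.le_induction with
  | base => simp [mcp_zero]
  | succ b hab ih =>
    rw [Finset.sum_Ico_succ_top hab]
    have := mcp_add_le hgam hlam (sub_nonneg.2 (hF hab)) (sub_nonneg.2 (hF b.le_succ))
    have e : F b - F a + (F b.succ - F b) = F (b + 1) - F a := by
      simp only [Nat.succ_eq_add_one]; ring
    rw [e] at this
    simp only [Nat.succ_eq_add_one] at this
    linarith

/-- The penalty is certified by a potential whose increments dominate the pairwise penalties. -/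
theorem exists_potential {K : ℕ} {gam lam : ℝ} (hgam : 0 < gam) (hlam : 0 < lam)
    (theta : Fin K → ℝ) :
    ∃ ψ : Fin K → ℝ, (∀ k, 0 ≤ ψ k) ∧ (∀ k, ψ k ≤ penalty gam lam theta) ∧
      ∀ k l, theta k ≤ theta l → mcp gam lam (theta l - theta k) ≤ ψ l - ψ k := by
  rcases Nat.eq_zero_or_pos K with rfl | hK
  · exact ⟨fun _ => 0, fun k => k.elim0, fun k => k.elim0, fun k => k.elim0⟩
  obtain ⟨F, hF, hFk, -, hpen⟩ := exists_monotone_seq hK gam lam theta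
  have hnn : ∀ m, 0 ≤ mcp gam lam (F (m + 1) - F m) := fun m =>
    mcp_nonneg hgam hlam (sub_nonneg.2 (hF m.le_succ))
  -- `ψ k` is the penalty accumulated below the rank of `k`.
  refine ⟨fun k => ∑ m ∈ Finset.range ((Tuple.sort theta).symm k), mcp gam lam (F (m + 1) - F m),
    fun k => Finset.sum_nonneg fun m _ => hnn m, fun k => ?_, fun k l hkl => ?_⟩
  · rw [hpen]
    refine Finset.sum_le_sum_of_subset_of_nonneg ?_ fun m _ _ => hnn m
    exact Finset.range_subset_range.2 (by omega)
  · simp only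
    rcases le_total ((Tuple.sort theta).symm k : ℕ) ((Tuple.sort theta).symm l) with h | h
    · rw [← Finset.sum_Ico_eq_sub _ h, ← hFk k, ← hFk l]
      exact mcp_sub_le_sum hgam hlam hF h
    -- Ranks in reverse order force a tie, so every gap between them is zero.
    · have h1 := hF h
      rw [hFk, hFk] at h1
      have h2 : theta k = theta l := le_antisymm hkl h1
      rw [h2, sub_self, mcp_zero, ← neg_sub, ← Finset.sum_Ico_eq_sub _ h, neg_nonneg]
      refine Finset.sum_nonpos fun m hm => ?_
      rw [Finset.mem_Ico] at hm
      have h3 := hF hm.1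
      have h4 : F (m + 1) ≤ F ((Tuple.sort theta).symm k) := hF (by omega)
      rw [hFk] at h3 h4
      rw [← mcp_zero gam lam]
      exact mcp_mono hgam hlam (by linarith)

theorem penalty_nonneg {K : ℕ} {gam lam : ℝ} (hgam : 0 < gam) (hlam : 0 < lam)
    (theta : Fin K → ℝ) : 0 ≤ penalty gam lam theta :=
  Finset.sum_nonneg fun k _ => mcp_nonneg hgam hlam
    (sub_nonneg.2 (Tuple.monotone_sort theta (by simp [Fin.le_def])))

/-- Using fewer values does not increase the penalty. -/
theorem penalty_le_of_range_subset {K : ℕ} {gam lam : ℝ} (hgam : 0 < gam) (hlam : 0 < lam)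
    {theta theta' : Fin K → ℝ} (h : Set.range theta' ⊆ Set.range theta) :
    penalty gam lam theta' ≤ penalty gam lam theta := by
  rcases Nat.eq_zero_or_pos K with rfl | hK
  · simp [penalty]
  obtain ⟨ψ, hψ0, hψ1, hψ⟩ := exists_potential hgam hlam theta
  obtain ⟨F, hF, -, hFr, hpen⟩ := exists_monotone_seq hK gam lam theta'
  have hex : ∀ m, ∃ k : Fin K, m < K → theta k = F m := by
    intro m
    by_cases hm : m < K
    · obtain ⟨k, hk⟩ := h (hFr ⟨m, hm⟩)
      exact ⟨k, fun _ => hk⟩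
    · exact ⟨⟨0, hK⟩, fun h => absurd h hm⟩
  choose u hu using hex
  rw [hpen]
  -- Each order statistic of `theta'` is an entry of `theta`, so its gaps are charged to increments
  -- of `ψ`, which telescope.
  calc ∑ m ∈ Finset.range (K - 1), mcp gam lam (F (m + 1) - F m)
      ≤ ∑ m ∈ Finset.range (K - 1), (ψ (u (m + 1)) - ψ (u m)) := by
        refine Finset.sum_le_sum fun m hm => ?_
        rw [Finset.mem_range] at hm
        have h1 := hu m (by omega)
        have h2 := hu (m + 1) (by omega)
        rw [← h1, ← h2]
        apply hψ
        rw [h1, h2]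
        exact hF m.le_succ
    _ = ψ (u (K - 1)) - ψ (u 0) := Finset.sum_range_sub (fun m => ψ (u m)) _
    _ ≤ penalty gam lam theta := by linarith [hψ1 (u (K - 1)), hψ0 (u 0)]

/-- The penalty is at most the largest one for the number of gaps between distinct values. -/
theorem penalty_add_le_card {K : ℕ} (hK : 0 < K) {gam lam : ℝ} (hgam : 0 < gam) (hlam : 0 < lam)
    (theta : Fin K → ℝ) :
    penalty gam lam theta + gam * lam ^ 2 / 2
      ≤ (Finset.univ.image theta).card * (gam * lam ^ 2 / 2) := by
  obtain ⟨F, hF, -, hFr, hpen⟩ := exists_monotone_seq hK gam lam theta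
  set J := (Finset.range (K - 1)).filter fun m => F m < F (m + 1) with hJ
  have h1 : penalty gam lam theta ≤ J.card * (gam * lam ^ 2 / 2) := by
    rw [hpen, ← nsmul_eq_mul, ← Finset.sum_const, hJ, Finset.sum_filter]
    refine Finset.sum_le_sum fun m _ => ?_
    split_ifs with h
    · exact mcp_le hgam hlam _
    · rw [← mcp_zero gam lam]
      exact mcp_mono hgam hlam (by linarith)
  -- Strict jumps map injectively to their upper ends, and none of these is the minimum `F 0`.
  have h2 : J.card + 1 ≤ (Finset.univ.image theta).card := by
    have hmem : ∀ m, m < K → F m ∈ Finset.univ.image theta := fun m hm => by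
      simpa using hFr ⟨m, hm⟩
    have hinj : Set.InjOn (fun m => F (m + 1)) J := by
      have hlt : ∀ a b, b ∈ J → a < b → F (a + 1) < F (b + 1) := fun a b hb hab =>
        (hF hab).trans_lt (Finset.mem_filter.1 hb).2
      intro a ha b hb hab
      rcases lt_trichotomy a b with h | h | h
      · exact absurd hab (hlt a b hb h).ne
      · exact h
      · exact absurd hab (hlt b a ha h).ne'
    rw [← Finset.card_image_of_injOn hinj,
      ← Finset.card_erase_add_one (hmem 0 hK)]
    refine Nat.add_le_add_right (Finset.card_le_card fun x hx => ?_) 1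
    obtain ⟨m, hm, rfl⟩ := Finset.mem_image.1 hx
    have hm' := Finset.mem_filter.1 hm
    refine Finset.mem_erase.2 ⟨((hF m.zero_le).trans_lt hm'.2).ne', hmem _ ?_⟩
    have := Finset.mem_range.1 hm'.1
    omega
  have h3 : ((J.card : ℝ) + 1) ≤ (Finset.univ.image theta).card := by exact_mod_cast h2
  have h4 : 0 ≤ gam * lam ^ 2 / 2 := by positivity
  nlinarith

/-! ### Fitting a single group -/

/-- The weighted mean of `y` over `I`. -/
noncomputable def weightedMean {ι : Type*} (w y : ι → ℝ) (I : Finset ι) : ℝ :=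
  (∑ k ∈ I, w k * y k) / ∑ k ∈ I, w k

section Group

variable {ι : Type*} {w y theta : ι → ℝ} {I : Finset ι}

theorem sum_mul_sub_weightedMean (hp : ∑ k ∈ I, w k ≠ 0) :
    ∑ k ∈ I, w k * (y k - weightedMean w y I) = 0 := by
  simp only [mul_sub, Finset.sum_sub_distrib, ← Finset.sum_mul, weightedMean]
  field_simp
  ring

/-- Pythagoras: the residuals about the mean are orthogonal to constants. -/
theorem sum_sq_sub_const (hp : ∑ k ∈ I, w k ≠ 0) (c : ℝ) :
    ∑ k ∈ I, w k / 2 * (y k - c) ^ 2 =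
      ∑ k ∈ I, w k / 2 * (y k - weightedMean w y I) ^ 2
        + (∑ k ∈ I, w k) / 2 * (weightedMean w y I - c) ^ 2 := by
  have h0 := sum_mul_sub_weightedMean (y := y) hp
  set m := weightedMean w y I
  have : ∀ k ∈ I, w k / 2 * (y k - c) ^ 2 = w k / 2 * (y k - m) ^ 2
      + (w k * (y k - m)) * (m - c) + w k * ((m - c) ^ 2 / 2) := fun k _ => by ring
  rw [Finset.sum_congr rfl this, Finset.sum_add_distrib, Finset.sum_add_distrib,
    ← Finset.sum_mul, ← Finset.sum_mul, h0]
  ring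

theorem abs_weightedMean_sub_le (hw : ∀ k ∈ I, 0 < w k) (hI : I.Nonempty) {mu t : ℝ}
    (hy : ∀ k ∈ I, |y k - mu| ≤ t) : |weightedMean w y I - mu| ≤ t := by
  have hp : 0 < ∑ k ∈ I, w k := Finset.sum_pos hw hI
  have h1 : weightedMean w y I - mu = (∑ k ∈ I, w k * (y k - mu)) / ∑ k ∈ I, w k := by
    simp only [mul_sub, Finset.sum_sub_distrib, ← Finset.sum_mul, weightedMean]
    field_simp
  rw [h1, abs_div, abs_of_pos hp, div_le_iff₀ hp, mul_comm t, Finset.sum_mul]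
  refine (Finset.abs_sum_le_sum_abs _ _).trans (Finset.sum_le_sum fun k hk => ?_)
  rw [abs_mul, abs_of_pos (hw k hk)]
  exact mul_le_mul_of_nonneg_left (hy k hk) (hw k hk).le

theorem sum_sq_sub_weightedMean_le (hw : ∀ k ∈ I, 0 < w k) (hI : I.Nonempty) {mu t : ℝ}
    (hy : ∀ k ∈ I, |y k - mu| ≤ t) :
    ∑ k ∈ I, w k / 2 * (y k - weightedMean w y I) ^ 2 ≤ (∑ k ∈ I, w k) * t ^ 2 / 2 := by
  have hp : 0 < ∑ k ∈ I, w k := Finset.sum_pos hw hI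
  have h1 := sum_sq_sub_const (y := y) hp.ne' mu
  have h2 : ∑ k ∈ I, w k / 2 * (y k - mu) ^ 2 ≤ (∑ k ∈ I, w k) * t ^ 2 / 2 := by
    rw [mul_div_assoc, Finset.sum_mul]
    refine Finset.sum_le_sum fun k hk => ?_
    have h3 : (y k - mu) ^ 2 ≤ t ^ 2 := sq_le_sq' (abs_le.1 (hy k hk)).1 (abs_le.1 (hy k hk)).2
    have := hw k hk
    nlinarith
  have h3 : 0 ≤ (∑ k ∈ I, w k) / 2 * (weightedMean w y I - mu) ^ 2 := by positivity
  linarith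

/-- Splitting a group does not pay: within a group of small noise, the weighted mean beats any
other fit, if the latter pays the penalty of its range. -/
theorem eq_or_sum_sq_lt_add_mcp {gam lam : ℝ} (hgam : 0 < gam) (hlam : 0 < lam)
    (hw : ∀ k ∈ I, 0 < w k) {mu t : ℝ} (hy : ∀ k ∈ I, |y k - mu| ≤ t)
    (ht1 : (∑ k ∈ I, w k) * t ≤ lam / 2) (ht2 : (∑ k ∈ I, w k) * t ^ 2 ≤ gam * lam ^ 2 / 4)
    {a b : ι} (ha : a ∈ I) (hab : ∀ k ∈ I, theta a ≤ theta k ∧ theta k ≤ theta b) :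
    (theta b = theta a ∧ ∀ k ∈ I, theta k = weightedMean w y I) ∨
      ∑ k ∈ I, w k / 2 * (y k - weightedMean w y I) ^ 2 <
        ∑ k ∈ I, w k / 2 * (y k - theta k) ^ 2 + mcp gam lam (theta b - theta a) := by
  have hI : I.Nonempty := ⟨a, ha⟩
  have hp : 0 < ∑ k ∈ I, w k := Finset.sum_pos hw hI
  have hnn : 0 ≤ ∑ k ∈ I, w k / 2 * (y k - theta k) ^ 2 :=
    Finset.sum_nonneg fun k hk => mul_nonneg (half_pos (hw k hk)).le (sq_nonneg _)
  rcases eq_or_lt_of_le (hab a ha).2 with h | h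
  · have hc : ∀ k ∈ I, theta k = theta a := fun k hk =>
      le_antisymm (h ▸ (hab k hk).2) (hab k hk).1
    by_cases hm : weightedMean w y I = theta a
    · exact Or.inl ⟨h.symm, fun k hk => (hc k hk).trans hm.symm⟩
    · right
      have e : ∑ k ∈ I, w k / 2 * (y k - theta k) ^ 2 = ∑ k ∈ I, w k / 2 * (y k - theta a) ^ 2 :=
        Finset.sum_congr rfl fun k hk => by rw [hc k hk]
      rw [← h, sub_self, mcp_zero, add_zero, e, sum_sq_sub_const hp.ne' (theta a)]
      have : 0 < (weightedMean w y I - theta a) ^ 2 := by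
        have := sub_ne_zero.2 hm
        positivity
      have : 0 < (∑ k ∈ I, w k) / 2 * (weightedMean w y I - theta a) ^ 2 := by positivity
      linarith
  right
  -- A range of at least `γλ` pays `γλ²/2`, more than the noise `γλ²/8`. A shorter range `d` pays
  -- more than `λd/2`, while the loss drops by at most `(∑ w) t d ≤ λd/2`.
  rcases le_or_gt (gam * lam) (theta b - theta a) with h' | h'
  · rw [mcp_of_le hgam hlam h']
    have := sum_sq_sub_weightedMean_le hw hI hy
    have : 0 < gam * lam ^ 2 := by positivity
    linarith
  · have h1 := half_mul_lt_mcp hgam hlam (sub_pos.2 h) h'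
    have hm := abs_weightedMean_sub_le hw hI hy
    have h0 := sum_mul_sub_weightedMean (y := y) hp.ne'
    set m := weightedMean w y I
    set c := (theta a + theta b) / 2 with hc
    -- Residuals sum to zero, so the linear term may be recentred at the midpoint `c`, where `|theta
    -- k - c|` is at most half the range.
    have h2 : ∑ k ∈ I, w k / 2 * (y k - m) ^ 2 - ∑ k ∈ I, w k / 2 * (y k - theta k) ^ 2
        ≤ ∑ k ∈ I, w k * (y k - m) * (theta k - c) := by
      have h3 : ∑ k ∈ I, w k * (y k - m) * (c - m) = 0 := by rw [← Finset.sum_mul, h0, zero_mul]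
      rw [← Finset.sum_sub_distrib, ← add_zero (∑ k ∈ I, w k * (y k - m) * (theta k - c)), ← h3,
        ← Finset.sum_add_distrib]
      refine Finset.sum_le_sum fun k hk => ?_
      have := hw k hk
      nlinarith [mul_nonneg this.le (sq_nonneg (theta k - m))]
    have h4 : ∑ k ∈ I, w k * (y k - m) * (theta k - c)
        ≤ (∑ k ∈ I, w k) * (t * (theta b - theta a)) := by
      rw [Finset.sum_mul]
      refine Finset.sum_le_sum fun k hk => ?_
      rw [mul_assoc]
      refine mul_le_mul_of_nonneg_left ?_ (hw k hk).le
      have e1 : |y k - m| ≤ 2 * t := by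
        have := hy k hk
        rw [abs_le] at this hm ⊢
        constructor <;> linarith
      have e2 : |theta k - c| ≤ (theta b - theta a) / 2 := by
        have := hab k hk
        rw [abs_le]
        constructor <;> linarith
      calc (y k - m) * (theta k - c) ≤ |y k - m| * |theta k - c| := by
            rw [← abs_mul]; exact le_abs_self _
        _ ≤ 2 * t * ((theta b - theta a) / 2) :=
            mul_le_mul e1 e2 (abs_nonneg _) ((abs_nonneg _).trans e1)
        _ = t * (theta b - theta a) := by ring
    have h5 : (∑ k ∈ I, w k) * (t * (theta b - theta a)) ≤ lam / 2 * (theta b - theta a) := by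
      rw [← mul_assoc]
      exact mul_le_mul_of_nonneg_right ht1 (sub_pos.2 h).le
    linarith

/-- A fit that is far from all the responses of a group has a large loss. -/
theorem le_sum_sq_of_far (hw : ∀ k ∈ I, 0 < w k) {mu t r : ℝ} (hy : ∀ k ∈ I, |y k - mu| ≤ t)
    (htr : t ≤ r) (hfar : ∀ k ∈ I, r < |theta k - mu|) :
    (∑ k ∈ I, w k) * (r - t) ^ 2 / 2 ≤ ∑ k ∈ I, w k / 2 * (y k - theta k) ^ 2 := by
  rw [mul_div_assoc, Finset.sum_mul]
  refine Finset.sum_le_sum fun k hk => ?_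
  have h1 : r - t ≤ |y k - theta k| := by
    have h2 := abs_sub_abs_le_abs_sub (theta k - mu) (y k - mu)
    rw [sub_sub_sub_cancel_right, abs_sub_comm (theta k) (y k)] at h2
    linarith [hy k hk, hfar k hk]
  have h2 : (r - t) ^ 2 ≤ (y k - theta k) ^ 2 := by
    rw [← sq_abs (y k - theta k)]
    exact pow_le_pow_left₀ (by linarith) h1 2
  have := hw k hk
  nlinarith

end Group

/-! ### Comparing the group means with a general fit -/

/-- The penalty is bounded below by that of a chain of well-separated intervals. -/
theorem sum_mcp_le_penalty {K : ℕ} {gam lam : ℝ} (hgam : 0 < gam) (hlam : 0 < lam)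
    (theta : Fin K → ℝ) (a b : ℝ → Fin K) (S : Finset ℝ)
    (hab : ∀ g ∈ S, theta (a g) ≤ theta (b g))
    (hsep : ∀ g ∈ S, ∀ h ∈ S, g < h → theta (b g) + gam * lam ≤ theta (a h)) :
    ∑ g ∈ S, (mcp gam lam (theta (b g) - theta (a g)) + gam * lam ^ 2 / 2)
      ≤ penalty gam lam theta + gam * lam ^ 2 / 2 := by
  obtain ⟨ψ, hψ0, hψ1, hψ⟩ := exists_potential hgam hlam theta
  have hgl : 0 < gam * lam := by positivity
  -- Induction on the topmost interval: `ψ` rises by `mcp` of each range and by a full `γλ²/2`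
  -- across each separation. The last interval has no separation above it, whence the extra `γλ²/2`
  -- in the conclusion.
  have key : ∀ S : Finset ℝ, (∀ g ∈ S, theta (a g) ≤ theta (b g)) →
      (∀ g ∈ S, ∀ h ∈ S, g < h → theta (b g) + gam * lam ≤ theta (a h)) →
      ∀ u, (∀ g ∈ S, theta (b g) + gam * lam ≤ theta u) →
        ∑ g ∈ S, (mcp gam lam (theta (b g) - theta (a g)) + gam * lam ^ 2 / 2) ≤ ψ u := by
    intro S
    induction S using Finset.induction_on_max with
    | empty => intro _ _ u _; simpa using hψ0 u
    | insert h S hS ih =>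
      intro hab hsep u hu
      rw [Finset.sum_insert fun hmem => (hS h hmem).false]
      have h1 := ih (fun g hg => hab g (Finset.mem_insert_of_mem hg))
        (fun g hg g' hg' => hsep g (Finset.mem_insert_of_mem hg) g' (Finset.mem_insert_of_mem hg'))
        (a h) (fun g hg => hsep g (Finset.mem_insert_of_mem hg) h (Finset.mem_insert_self _ _)
          (hS g hg))
      have h2 := hψ (a h) (b h) (hab h (Finset.mem_insert_self _ _))
      have h3 := hu h (Finset.mem_insert_self _ _)
      have h4 := hψ (b h) u (by linarith)
      rw [mcp_of_le hgam hlam (by linarith)] at h4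
      linarith
  rcases S.eq_empty_or_nonempty with rfl | hne
  · have := penalty_nonneg hgam hlam theta
    have : 0 < gam * lam ^ 2 := by positivity
    simp only [Finset.sum_empty]
    linarith
  · have hmem := S.max'_mem hne
    set h := S.max' hne
    rw [← Finset.add_sum_erase S _ hmem]
    have h1 := key (S.erase h) (fun g hg => hab g (Finset.mem_of_mem_erase hg))
      (fun g hg g' hg' => hsep g (Finset.mem_of_mem_erase hg) g' (Finset.mem_of_mem_erase hg'))
      (a h) (fun g hg => hsep g (Finset.mem_of_mem_erase hg) h hmem
        ((S.le_max' g (Finset.mem_of_mem_erase hg)).lt_of_ne (Finset.ne_of_mem_erase hg)))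
    have h2 := hψ (a h) (b h) (hab h hmem)
    have h3 := hψ1 (b h)
    linarith

/-- The weighted means over the groups of equal entries of `theta0`. -/
noncomputable def groupMean {K : ℕ} (w y theta0 : Fin K → ℝ) (k : Fin K) : ℝ :=
  weightedMean w y (Finset.univ.filter fun l => theta0 l = theta0 k)

theorem groupMean_congr {K : ℕ} {w y theta0 : Fin K → ℝ} {k l : Fin K}
    (h : theta0 k = theta0 l) : groupMean w y theta0 k = groupMean w y theta0 l := by
  rw [groupMean, groupMean, h]

theorem penalty_groupMean_add_le {K : ℕ} (hK : 0 < K) {gam lam : ℝ} (hgam : 0 < gam)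
    (hlam : 0 < lam) (w y theta0 : Fin K → ℝ) :
    penalty gam lam (groupMean w y theta0) + gam * lam ^ 2 / 2
      ≤ (Finset.univ.image theta0).card * (gam * lam ^ 2 / 2) := by
  refine (penalty_add_le_card hK hgam hlam _).trans ?_
  have h : Finset.univ.image (groupMean w y theta0)
      = (Finset.univ.image theta0).image
        fun g => weightedMean w y (Finset.univ.filter fun l => theta0 l = g) := by
    rw [Finset.image_image]
    rfl
  rw [h]
  exact mul_le_mul_of_nonneg_right (Nat.cast_le.2 Finset.card_image_le) (by positivity)

theorem sum_eq_sum_groups {K : ℕ} (theta0 f : Fin K → ℝ) :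
    ∑ k, f k = ∑ g ∈ Finset.univ.image theta0,
      ∑ k ∈ Finset.univ.filter (fun l => theta0 l = g), f k :=
  (Finset.sum_fiberwise_of_maps_to (fun k _ => Finset.mem_image_of_mem _ (Finset.mem_univ k)) f).symm

/-- If every entry of `theta` is the nearest one to its response, then the group means have a
smaller objective than `theta`. -/
theorem groupMean_lt_of_nearest {K : ℕ} (hK : 0 < K) {gam lam : ℝ} (hgam : 0 < gam)
    (hlam : 0 < lam) {w y theta0 : Fin K → ℝ} (hw : ∀ k, 0 < w k) {c t r : ℝ} (htr : t ≤ r)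
    (hy : ∀ k, |y k - (theta0 k + c)| ≤ t)
    (ht1 : ∀ k, (∑ l ∈ Finset.univ.filter (fun l => theta0 l = theta0 k), w l) * t ≤ lam / 2)
    (ht2 : ∀ k, (∑ l ∈ Finset.univ.filter (fun l => theta0 l = theta0 k), w l) * t ^ 2
      ≤ gam * lam ^ 2 / 4)
    (hr : ∀ k, 2 * (gam * lam ^ 2) ≤
      (∑ l ∈ Finset.univ.filter (fun l => theta0 l = theta0 k), w l) * (r - t) ^ 2)
    (hgap : ∀ k l, theta0 k < theta0 l → gam * lam + 2 * (r + 2 * t) ≤ theta0 l - theta0 k)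
    {theta : Fin K → ℝ} (hnear : ∀ k l, |y k - theta k| ≤ |y k - theta l|)
    (hne : theta ≠ groupMean w y theta0) :
    ∑ k, w k / 2 * (y k - groupMean w y theta0 k) ^ 2
        + penalty gam lam (groupMean w y theta0)
      < ∑ k, w k / 2 * (y k - theta k) ^ 2 + penalty gam lam theta := by
  classical
  set I : ℝ → Finset (Fin K) := fun g => Finset.univ.filter fun l => theta0 l = g with hI
  set G := Finset.univ.image theta0 with hG
  have hmemI : ∀ {g k}, k ∈ I g ↔ theta0 k = g := by simp [hI]
  have hex : ∀ g, ∃ ab : Fin K × Fin K, g ∈ G → ab.1 ∈ I g ∧ ab.2 ∈ I g ∧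
      ∀ k ∈ I g, theta ab.1 ≤ theta k ∧ theta k ≤ theta ab.2 := by
    intro g
    by_cases hg : g ∈ G
    · obtain ⟨k, -, hk⟩ := Finset.mem_image.1 hg
      have hne : (I g).Nonempty := ⟨k, hmemI.2 hk⟩
      obtain ⟨a, ha, ha'⟩ := Finset.exists_min_image (I g) theta hne
      obtain ⟨b, hb, hb'⟩ := Finset.exists_max_image (I g) theta hne
      exact ⟨(a, b), fun _ => ⟨ha, hb, fun k hk => ⟨ha' k hk, hb' k hk⟩⟩⟩
    · exact ⟨(⟨0, hK⟩, ⟨0, hK⟩), fun h => absurd h hg⟩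
  choose ab hab using hex
  -- `S` collects the good groups.
  set S := G.filter fun g => ∃ k ∈ I g, |theta k - (g + c)| ≤ r with hS
  have hyI : ∀ g, ∀ k ∈ I g, |y k - (g + c)| ≤ t := fun g k hk => hmemI.1 hk ▸ hy k
  -- The value `theta k` is within `r + t` of `y l`, so the nearest value `theta l` is too.
  have hnearS : ∀ g ∈ S, ∀ l ∈ I g, |theta l - (g + c)| ≤ r + 2 * t := by
    intro g hg l hl
    obtain ⟨-, k, -, hkr⟩ := Finset.mem_filter.1 hg
    have h1 := hyI g l hl
    have h2 := hnear l k
    have h3 : |y l - theta k| ≤ t + r := by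
      rw [abs_le] at *
      constructor <;> linarith
    have h4 := h2.trans h3
    rw [abs_le] at *
    constructor <;> linarith
  have hpen : ∑ g ∈ S, (mcp gam lam (theta (ab g).2 - theta (ab g).1) + gam * lam ^ 2 / 2)
      ≤ penalty gam lam theta + gam * lam ^ 2 / 2 := by
    refine sum_mcp_le_penalty hgam hlam theta (fun g => (ab g).1) (fun g => (ab g).2) S ?_ ?_
    · intro g hg
      have := hab g (Finset.mem_filter.1 hg).1
      exact (this.2.2 _ this.2.1).1
    · intro g hg h hh hgh
      have hg' := hab g (Finset.mem_filter.1 hg).1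
      have hh' := hab h (Finset.mem_filter.1 hh).1
      have h1 := (abs_le.1 (hnearS g hg _ hg'.2.1)).2
      have h2 := (abs_le.1 (hnearS h hh _ hh'.1)).1
      have h3 := hgap (ab g).2 (ab h).1
      rw [hmemI.1 hg'.2.1, hmemI.1 hh'.1] at h3
      have := h3 hgh
      linarith
  rw [hS, Finset.sum_filter] at hpen
  have hpen0 := penalty_groupMean_add_le hK hgam hlam w y theta0
  rw [← hG, ← nsmul_eq_mul, ← Finset.sum_const] at hpen0
  have hgl : 0 < gam * lam ^ 2 := by positivity
  -- Each group mean is charged one jump `γλ²/2`. In a bad group the noise is at most `γλ²/8` and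
  -- the loss of `theta` at least `γλ²`. The equality alternative is kept to trace strictness to a
  -- group where `theta` differs.
  have key : ∀ g ∈ G, (∀ k ∈ I g, theta k = groupMean w y theta0 k) ∧
        ∑ k ∈ I g, w k / 2 * (y k - groupMean w y theta0 k) ^ 2 + gam * lam ^ 2 / 2 =
        ∑ k ∈ I g, w k / 2 * (y k - theta k) ^ 2 + (if ∃ k ∈ I g, |theta k - (g + c)| ≤ r then
          mcp gam lam (theta (ab g).2 - theta (ab g).1) + gam * lam ^ 2 / 2 else 0) ∨
      ∑ k ∈ I g, w k / 2 * (y k - groupMean w y theta0 k) ^ 2 + gam * lam ^ 2 / 2 <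
        ∑ k ∈ I g, w k / 2 * (y k - theta k) ^ 2 + (if ∃ k ∈ I g, |theta k - (g + c)| ≤ r then
          mcp gam lam (theta (ab g).2 - theta (ab g).1) + gam * lam ^ 2 / 2 else 0) := by
    intro g hg
    obtain ⟨hag, hbg, habg⟩ := hab g hg
    have hgm : ∀ k ∈ I g, groupMean w y theta0 k = weightedMean w y (I g) := by
      intro k hk
      rw [groupMean, hmemI.1 hk]
    have e : ∑ k ∈ I g, w k / 2 * (y k - groupMean w y theta0 k) ^ 2
        = ∑ k ∈ I g, w k / 2 * (y k - weightedMean w y (I g)) ^ 2 :=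
      Finset.sum_congr rfl fun k hk => by rw [hgm k hk]
    have ht1' := ht1 (ab g).1
    have ht2' := ht2 (ab g).1
    have hr' := hr (ab g).1
    rw [hmemI.1 hag] at ht1' ht2' hr'
    rw [e]
    split_ifs with hgood
    · rcases eq_or_sum_sq_lt_add_mcp hgam hlam (fun k _ => hw k) (hyI g) ht1' ht2' hag habg with
        ⟨h1, h2⟩ | h
      · refine Or.inl ⟨fun k hk => (h2 k hk).trans (hgm k hk).symm, ?_⟩
        rw [h1, sub_self, mcp_zero, zero_add]
        congr 1
        exact Finset.sum_congr rfl fun k hk => by rw [h2 k hk]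
      · right
        linarith
    · right
      push Not at hgood
      have h1 := le_sum_sq_of_far (fun k _ => hw k) (hyI g) htr hgood
      have h2 := sum_sq_sub_weightedMean_le (fun k _ => hw k) ⟨_, hag⟩ (hyI g)
      linarith
  obtain ⟨k, hk⟩ := Function.ne_iff.1 hne
  have hlt := Finset.sum_lt_sum (fun g hg => (key g hg).elim (fun h => h.2.le) le_of_lt)
    ⟨theta0 k, Finset.mem_image_of_mem _ (Finset.mem_univ k),
      (key _ (Finset.mem_image_of_mem _ (Finset.mem_univ k))).elim
        (fun h => absurd (h.1 k (hmemI.2 rfl)) hk) id⟩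
  rw [Finset.sum_add_distrib, Finset.sum_add_distrib] at hlt
  rw [sum_eq_sum_groups theta0 fun k => w k / 2 * (y k - groupMean w y theta0 k) ^ 2,
    sum_eq_sum_groups theta0 fun k => w k / 2 * (y k - theta k) ^ 2]
  linarith

/-- Moving every entry to the nearest value reduces the objective. -/
theorem exists_nearest {K : ℕ} {gam lam : ℝ} (hgam : 0 < gam) (hlam : 0 < lam)
    {w : Fin K → ℝ} (hw : ∀ k, 0 < w k) (y theta : Fin K → ℝ)
    (hnot : ¬ ∀ k l, |y k - theta k| ≤ |y k - theta l|) :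
    ∃ theta' : Fin K → ℝ, (∀ k l, |y k - theta' k| ≤ |y k - theta' l|) ∧
      ∑ k, w k / 2 * (y k - theta' k) ^ 2 + penalty gam lam theta'
        < ∑ k, w k / 2 * (y k - theta k) ^ 2 + penalty gam lam theta := by
  have hex : ∀ k, ∃ l, ∀ l', |y k - theta l| ≤ |y k - theta l'| := fun k => by
    obtain ⟨l, -, hl⟩ := Finset.exists_min_image Finset.univ (fun l => |y k - theta l|)
      ⟨k, Finset.mem_univ k⟩
    exact ⟨l, fun l' => hl l' (Finset.mem_univ _)⟩
  choose u hu using hex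
  refine ⟨fun k => theta (u k), fun k l => hu k (u l), ?_⟩
  have h1 : penalty gam lam (fun k => theta (u k)) ≤ penalty gam lam theta :=
    penalty_le_of_range_subset hgam hlam (Set.range_comp_subset_range u theta)
  push Not at hnot
  obtain ⟨k, l, hkl⟩ := hnot
  have h2 : ∑ k, w k / 2 * (y k - theta (u k)) ^ 2 < ∑ k, w k / 2 * (y k - theta k) ^ 2 := by
    refine Finset.sum_lt_sum (fun k _ => ?_) ⟨k, Finset.mem_univ k, ?_⟩
    · exact mul_le_mul_of_nonneg_left (sq_le_sq.2 (hu k k)) (half_pos (hw k)).le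
    · exact mul_lt_mul_of_pos_left (sq_lt_sq.2 ((hu k l).trans_lt hkl)) (half_pos (hw k))
  linarith

/-! ### Reduction of the model to level means -/

/-- The weight of each level. -/
noncomputable def levelWeight {n K : ℕ} (X : Fin n → Fin K) (k : Fin K) : ℝ :=
  (levelCount X k : ℝ) / n

/-- The mean of the centred responses of each level. -/
noncomputable def levelMean {n K : ℕ} (X : Fin n → Fin K) (Y : Fin n → ℝ) (k : Fin K) : ℝ :=
  weightedMean (fun _ => 1) (fun i => Y i - muHat Y) (Finset.univ.filter fun i => X i = k)

section Level

variable {n K : ℕ} {X : Fin n → Fin K}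

theorem levelCount_eq_sum (X : Fin n → Fin K) (k : Fin K) :
    ∑ _i ∈ Finset.univ.filter (fun i => X i = k), (1 : ℝ) = levelCount X k := by
  simp [levelCount]

/-- Pythagoras within each level leaves a weighted problem on the levels. -/
theorem loss_eq (hX : ∀ k, 0 < levelCount X k) (Y : Fin n → ℝ) (theta : Fin K → ℝ) :
    loss X Y theta = loss X Y (levelMean X Y)
      + ∑ k, levelWeight X k / 2 * (levelMean X Y k - theta k) ^ 2 := by
  have key : ∀ th : Fin K → ℝ, loss X Y th = 1 / (n : ℝ) *
      ∑ k, ∑ i ∈ Finset.univ.filter (fun i => X i = k), 1 / 2 * (Y i - muHat Y - th k) ^ 2 := by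
    intro th
    have h1 : ∀ k, ∑ i ∈ Finset.univ.filter (fun i => X i = k),
        1 / 2 * (Y i - muHat Y - th k) ^ 2 =
        ∑ i ∈ Finset.univ.filter (fun i => X i = k), 1 / 2 * (Y i - muHat Y - th (X i)) ^ 2 :=
      fun k => Finset.sum_congr rfl fun i hi => by rw [(Finset.mem_filter.1 hi).2]
    simp only [h1]
    rw [Finset.sum_fiberwise, ← Finset.mul_sum, loss]
    ring
  rw [key theta, key (levelMean X Y), Finset.mul_sum, Finset.mul_sum, ← Finset.sum_add_distrib]
  refine Finset.sum_congr rfl fun k _ => ?_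
  have h0 : ∑ _i ∈ Finset.univ.filter (fun i => X i = k), (1 : ℝ) ≠ 0 := by
    rw [levelCount_eq_sum]
    exact_mod_cast (hX k).ne'
  rw [sum_sq_sub_const (w := fun _ => (1 : ℝ)) (y := fun i => Y i - muHat Y) h0 (theta k),
    levelCount_eq_sum, levelWeight, levelMean]
  ring

theorem sum_levelWeight_mul_levelMean (hX : ∀ k, 0 < levelCount X k) (Y : Fin n → ℝ) :
    ∑ k, levelWeight X k * levelMean X Y k = 0 := by
  have h1 : ∀ k, levelWeight X k * levelMean X Y k
      = (∑ i ∈ Finset.univ.filter (fun i => X i = k), (Y i - muHat Y)) / n := by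
    intro k
    have : (levelCount X k : ℝ) ≠ 0 := by exact_mod_cast (hX k).ne'
    rw [levelWeight, levelMean, weightedMean, levelCount_eq_sum]
    simp only [one_mul]
    field_simp
  simp only [h1]
  rw [← Finset.sum_div, Finset.sum_fiberwise, Finset.sum_sub_distrib]
  rcases Nat.eq_zero_or_pos n with rfl | hn
  · simp
  have : (n : ℝ) ≠ 0 := by exact_mod_cast hn.ne'
  simp only [muHat, Finset.sum_const, Finset.card_univ, Fintype.card_fin, nsmul_eq_mul]
  field_simp
  simp

theorem abs_levelMean_response_sub_le (hX : ∀ k, 0 < levelCount X k) (mu0 : ℝ)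
    (theta0 : Fin K → ℝ) (e : Fin n → ℝ) {t : ℝ} (k : Fin K)
    (he : |∑ i ∈ Finset.univ.filter (fun i => X i = k), e i| ≤ levelCount X k * t) :
    |levelMean X (response X mu0 theta0 e) k
      - (theta0 k + (mu0 - muHat (response X mu0 theta0 e)))| ≤ t := by
  have h0 : (0 : ℝ) < levelCount X k := by exact_mod_cast hX k
  have h1 : levelMean X (response X mu0 theta0 e) k
      - (theta0 k + (mu0 - muHat (response X mu0 theta0 e)))
      = (∑ i ∈ Finset.univ.filter (fun i => X i = k), e i) / levelCount X k := by
    rw [levelMean, weightedMean, levelCount_eq_sum, sub_eq_iff_eq_add, div_add' _ _ _ h0.ne']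
    congr 1
    rw [← levelCount_eq_sum, Finset.mul_sum, ← Finset.sum_add_distrib]
    refine Finset.sum_congr rfl fun i hi => ?_
    rw [response, (Finset.mem_filter.1 hi).2]
    ring
  rw [h1, abs_div, abs_of_pos h0, div_le_iff₀ h0, mul_comm]
  exact he

theorem sum_levelWeight_eq (theta0 : Fin K → ℝ) (k : Fin K) :
    ∑ l ∈ Finset.univ.filter (fun l => theta0 l = theta0 k), levelWeight X l
      = (fusedCount X theta0 k : ℝ) / n := by
  simp only [levelWeight, fusedCount, Nat.cast_sum, Finset.sum_div]

end Level

/-- Averaging within groups keeps the weighted total, which puts the group means in `Theta`. -/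
theorem sum_mul_groupMean {K : ℕ} {w : Fin K → ℝ} (hw : ∀ k, 0 < w k) (y theta0 : Fin K → ℝ) :
    ∑ k, w k * groupMean w y theta0 k = ∑ k, w k * y k := by
  rw [sum_eq_sum_groups theta0 fun k => w k * y k,
    sum_eq_sum_groups theta0 fun k => w k * groupMean w y theta0 k]
  refine Finset.sum_congr rfl fun g hg => ?_
  obtain ⟨k0, -, hk0⟩ := Finset.mem_image.1 hg
  have hne : (Finset.univ.filter fun l => theta0 l = g).Nonempty := ⟨k0, by simp [hk0]⟩
  have h := sum_mul_sub_weightedMean (y := y) (Finset.sum_pos (fun k _ => hw k) hne).ne'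
  simp only [mul_sub, Finset.sum_sub_distrib] at h
  rw [sub_eq_zero.1 h]
  refine Finset.sum_congr rfl fun k hk => ?_
  rw [groupMean, (Finset.mem_filter.1 hk).2]

/-- The group means are the best fit among those that are constant on the groups. -/
theorem sum_sq_groupMean_lt {K : ℕ} {w : Fin K → ℝ} (hw : ∀ k, 0 < w k) (y theta0 : Fin K → ℝ)
    {theta : Fin K → ℝ} (hconst : ∀ k l, theta0 k = theta0 l → theta k = theta l)
    (hne : theta ≠ groupMean w y theta0) :
    ∑ k, w k / 2 * (y k - groupMean w y theta0 k) ^ 2 < ∑ k, w k / 2 * (y k - theta k) ^ 2 := by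
  rw [sum_eq_sum_groups theta0 fun k => w k / 2 * (y k - groupMean w y theta0 k) ^ 2,
    sum_eq_sum_groups theta0 fun k => w k / 2 * (y k - theta k) ^ 2]
  have key : ∀ k0, ∑ k ∈ Finset.univ.filter (fun l => theta0 l = theta0 k0),
        w k / 2 * (y k - theta k) ^ 2
      = ∑ k ∈ Finset.univ.filter (fun l => theta0 l = theta0 k0),
        w k / 2 * (y k - groupMean w y theta0 k) ^ 2
        + (∑ k ∈ Finset.univ.filter (fun l => theta0 l = theta0 k0), w k) / 2
          * (groupMean w y theta0 k0 - theta k0) ^ 2 ∧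
      0 < ∑ k ∈ Finset.univ.filter (fun l => theta0 l = theta0 k0), w k := by
    intro k0
    have hpos : 0 < ∑ k ∈ Finset.univ.filter (fun l => theta0 l = theta0 k0), w k :=
      Finset.sum_pos (fun k _ => hw k) ⟨k0, by simp⟩
    refine ⟨?_, hpos⟩
    have h1 := sum_sq_sub_const (y := y) hpos.ne' (theta k0)
    rw [← groupMean] at h1
    rw [Finset.sum_congr rfl fun k hk => by rw [hconst k k0 (Finset.mem_filter.1 hk).2], h1]
    congr 1
    exact Finset.sum_congr rfl fun k hk => by rw [groupMean_congr (Finset.mem_filter.1 hk).2]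
  refine Finset.sum_lt_sum (fun g hg => ?_) ?_
  · obtain ⟨k0, -, rfl⟩ := Finset.mem_image.1 hg
    obtain ⟨h1, h2⟩ := key k0
    rw [h1]
    have : 0 ≤ (∑ k ∈ Finset.univ.filter (fun l => theta0 l = theta0 k0), w k) / 2
          * (groupMean w y theta0 k0 - theta k0) ^ 2 := by positivity
    linarith
  · obtain ⟨k0, hk0⟩ := Function.ne_iff.1 hne
    refine ⟨theta0 k0, Finset.mem_image_of_mem _ (Finset.mem_univ _), ?_⟩
    obtain ⟨h1, h2⟩ := key k0
    rw [h1]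
    have h3 := sub_ne_zero.2 hk0.symm
    have : 0 < (∑ k ∈ Finset.univ.filter (fun l => theta0 l = theta0 k0), w k) / 2
          * (groupMean w y theta0 k0 - theta k0) ^ 2 := by positivity
    linarith

theorem argmin_eq_singleton {α : Type*} {f : α → ℝ} {S : Set α} {a : α} (ha : a ∈ S)
    (h : ∀ x ∈ S, x ≠ a → f a < f x) : argmin f S = {a} := by
  ext x
  constructor
  · rintro ⟨hx, hx'⟩
    by_contra hne
    exact absurd (hx' a ha) (not_le.2 (h x hx hne))
  · rintro rfl
    refine ⟨ha, fun y hy => ?_⟩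
    by_cases hyx : y = x
    · rw [hyx]
    · exact (h y hy hyx).le

/-- If the errors of each level average to at most `t`, then the group means are both the oracle
least squares estimate and the SCOPE estimate. -/
theorem estimates_eq_groupMean {n K : ℕ} (hn : 0 < n) {X : Fin n → Fin K}
    (hX : ∀ k, 0 < levelCount X k) (mu0 : ℝ) (theta0 : Fin K → ℝ) (e : Fin n → ℝ)
    {gam lam : ℝ} (hgam : 0 < gam) (hlam : 0 < lam) {t r : ℝ} (htr : t ≤ r)
    (he : ∀ k, |∑ i ∈ Finset.univ.filter (fun i => X i = k), e i| ≤ levelCount X k * t)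
    (ht1 : ∀ k, (fusedCount X theta0 k : ℝ) / n * t ≤ lam / 2)
    (ht2 : ∀ k, (fusedCount X theta0 k : ℝ) / n * t ^ 2 ≤ gam * lam ^ 2 / 4)
    (hr : ∀ k, 2 * (gam * lam ^ 2) ≤ (fusedCount X theta0 k : ℝ) / n * (r - t) ^ 2)
    (hgap : ∀ k l, theta0 k < theta0 l → gam * lam + 2 * (r + 2 * t) ≤ theta0 l - theta0 k) :
    ∃ thetaHat : Fin K → ℝ,
      oracleLSE X theta0 (response X mu0 theta0 e) = {thetaHat} ∧
      scopeEstimate gam lam X (response X mu0 theta0 e) = {thetaHat} := by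
  have hK : 0 < K := (X ⟨0, hn⟩).pos
  have hn' : (0 : ℝ) < n := by exact_mod_cast hn
  set Y := response X mu0 theta0 e
  have hw : ∀ k, 0 < levelWeight X k := fun k => div_pos (by exact_mod_cast hX k) hn'
  have hy := fun k => abs_levelMean_response_sub_le hX mu0 theta0 e k (he k)
  simp only [← sum_levelWeight_eq] at ht1 ht2 hr
  set m := groupMean (levelWeight X) (levelMean X Y) theta0 with hm
  have hmT : m ∈ Theta X := by
    have h := (sum_mul_groupMean hw (levelMean X Y) theta0).trans
      (sum_levelWeight_mul_levelMean hX Y)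
    simp only [levelWeight, div_mul_eq_mul_div, ← Finset.sum_div] at h
    rcases div_eq_zero_iff.1 h with h | h
    · exact h
    · exact absurd h hn'.ne'
  refine ⟨m, argmin_eq_singleton ⟨hmT, fun k l h => groupMean_congr h⟩ ?_,
    argmin_eq_singleton hmT ?_⟩
  · rintro th ⟨-, hth⟩ hne
    rw [loss_eq hX Y m, loss_eq hX Y th]
    linarith [sum_sq_groupMean_lt hw (levelMean X Y) theta0 hth hne]
  · intro th _ hne
    rw [objective, objective, loss_eq hX Y m, loss_eq hX Y th, add_assoc, add_assoc]
    refine add_lt_add_right ?_ _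
    have hlt : ∀ th' : Fin K → ℝ,
        (∀ k l, |levelMean X Y k - th' k| ≤ |levelMean X Y k - th' l|) → th' ≠ m → _ :=
      fun th' h1 h2 => groupMean_lt_of_nearest hK hgam hlam hw htr hy ht1 ht2 hr hgap h1 h2
    by_cases hnear : ∀ k l, |levelMean X Y k - th k| ≤ |levelMean X Y k - th l|
    · exact hlt th hnear hne
    -- `th'` may leave `Theta`, which is harmless: the comparison holds for all vectors.
    · obtain ⟨th', h1, h2⟩ := exists_nearest hgam hlam hw _ _ hnear
      by_cases h3 : th' = m
      · rwa [h3] at h2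
      · exact (hlt th' h1 h3).trans h2

/-! ### Probability bound and choice of constants -/

/-- A union bound for the errors of all the levels. -/
theorem measureReal_exists_lt_abs_sum_le {n K : ℕ} (X : Fin n → Fin K)
    (hX : ∀ k, 0 < levelCount X k)
    {Ω : Type*} [MeasurableSpace Ω] {P : Measure Ω} [IsProbabilityMeasure P]
    {ε : Fin n → Ω → ℝ} {σ : ℝ≥0} (hσ : 0 < σ) (hindep : iIndepFun ε P)
    (hsub : ∀ i, HasSubgaussianMGF (ε i) (σ ^ 2) P) {t : ℝ} (ht : 0 ≤ t) :
    P.real {ω | ∃ k, levelCount X k * t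
        < |∑ i ∈ Finset.univ.filter (fun i => X i = k), ε i ω|}
      ≤ K * (2 * Real.exp (-(minLevelCount X * t ^ 2 / (2 * (σ : ℝ) ^ 2)))) := by
  have hσ' : (0 : ℝ) < σ := hσ
  have hone : ∀ k, P.real {ω | levelCount X k * t
      < |∑ i ∈ Finset.univ.filter (fun i => X i = k), ε i ω|}
      ≤ 2 * Real.exp (-(minLevelCount X * t ^ 2 / (2 * (σ : ℝ) ^ 2))) := by
    intro k
    have h0 : (0 : ℝ) < levelCount X k := by exact_mod_cast hX k
    have hS := HasSubgaussianMGF.sum_of_iIndepFun hindep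
      (s := Finset.univ.filter fun i => X i = k) (fun i _ => hsub i)
    have hc : ((∑ _i ∈ Finset.univ.filter (fun i => X i = k), σ ^ 2 : ℝ≥0) : ℝ)
        = levelCount X k * (σ : ℝ) ^ 2 := by
      simp [levelCount]
    have hexp : Real.exp (-(levelCount X k * t) ^ 2
          / (2 * ((∑ _i ∈ Finset.univ.filter (fun i => X i = k), σ ^ 2 : ℝ≥0) : ℝ)))
        ≤ Real.exp (-(minLevelCount X * t ^ 2 / (2 * (σ : ℝ) ^ 2))) := by
      rw [hc, Real.exp_le_exp]
      have e1 : -(levelCount X k * t) ^ 2 / (2 * (levelCount X k * (σ : ℝ) ^ 2))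
          = -(levelCount X k * t ^ 2 / (2 * (σ : ℝ) ^ 2)) := by
        field_simp
      rw [e1, neg_le_neg_iff]
      have : (minLevelCount X : ℝ) ≤ levelCount X k :=
        Nat.cast_le.2 (ciInf_le (OrderBot.bddBelow _) k)
      gcongr
    have hpos : 0 ≤ levelCount X k * t := by positivity
    have h1 := (hS.measure_ge_le hpos).trans hexp
    have h2 := (hS.neg.measure_ge_le hpos).trans hexp
    refine (measureReal_mono (fun ω hω => ?_)).trans ((measureReal_union_le _ _).trans
      ((add_le_add h1 h2).trans_eq (two_mul _).symm))
    rcases lt_abs.1 (Set.mem_ofPred_eq ▸ hω) with h | h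
    · exact Or.inl h.le
    · exact Or.inr h.le
  rw [Set.ofPred_exists]
  refine (measureReal_iUnion_fintype_le _).trans ((Finset.sum_le_sum fun k _ => hone k).trans_eq ?_)
  simp

end SCOPE

theorem theorem1 {n K : ℕ} (hn : 0 < n) (X : Fin n → Fin K) (mu0 : ℝ) (theta0 : Fin K → ℝ)
    (htheta0 : theta0 ∈ SCOPE.Theta X)
    {Ω : Type*} [MeasurableSpace Ω] (P : Measure Ω) [IsProbabilityMeasure P]
    (ε : Fin n → Ω → ℝ) (σ : ℝ≥0) (hσ : 0 < σ)
    (hmean : ∀ i, ∫ ω, ε i ω ∂P = 0)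
    (hindep : iIndepFun ε P)
    (hsub : ∀ i, HasSubgaussianMGF (ε i) (σ ^ 2) P)
    (gam lam : ℝ) (hgam : 0 < gam) (hlam : 0 < lam)
    (η : ℝ) (hη0 : 0 < η) (hη1 : η ≤ 1)
    (s : ℕ) (hs : s = SCOPE.numGroups theta0)
    (hmin : η / s ≤ (SCOPE.minFusedCount X theta0 : ℝ) / n)
    (hmax : (SCOPE.maxFusedCount X theta0 : ℝ) / n ≤ 1 / (η * s))
    (hgap : ((3 * (1 + √2 / η) * √(gam * max gam (η * s)) * lam : ℝ) : EReal) ≤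
      SCOPE.minGap theta0) :
    ∃ A : Set Ω, MeasurableSet A ∧
      1 - 2 * Real.exp
          (-((SCOPE.minLevelCount X : ℝ) * η * s * min gam (η * s) * lam ^ 2 / (8 * (σ : ℝ) ^ 2))
            + Real.log K) ≤ P.real A ∧
      ∀ ω ∈ A, ∃ thetaHat : Fin K → ℝ,
        SCOPE.oracleLSE X theta0 (SCOPE.response X mu0 theta0 fun i => ε i ω) = {thetaHat} ∧
        SCOPE.scopeEstimate gam lam X (SCOPE.response X mu0 theta0 fun i => ε i ω) =
          {thetaHat} := by
  have hK : 0 < K := (X ⟨0, hn⟩).pos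
  have hK' : (1 : ℝ) ≤ K := by exact_mod_cast hK
  have hn' : (0 : ℝ) < n := by exact_mod_cast hn
  have : Nonempty (Fin K) := ⟨⟨0, hK⟩⟩
  rcases Nat.eq_zero_or_pos (SCOPE.minLevelCount X) with h0 | hpos
  -- With an empty level the claimed bound is `1 - 2K ≤ 0`.
  · refine ⟨∅, MeasurableSet.empty, ?_, fun ω hω => hω.elim⟩
    rw [h0]
    simp only [Nat.cast_zero, zero_mul, zero_div, neg_zero, zero_add, measureReal_empty]
    rw [Real.exp_log (by linarith)]
    linarith
  have hX : ∀ k, 0 < SCOPE.levelCount X k := fun k =>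
    hpos.trans_le (ciInf_le (OrderBot.bddBelow _) k)
  have hs0 : (0 : ℝ) < s := by
    rw [hs, SCOPE.numGroups]
    exact_mod_cast Finset.card_pos.2 (Finset.univ_nonempty.image theta0)
  have ha : 0 < η * s := by positivity
  set a := η * s with ha_def
  have hm : 0 < min gam a := lt_min hgam ha
  have hM : 0 < gam * max gam a := mul_pos hgam (hgam.trans_le (le_max_left _ _))
  set t := √(a * min gam a) * lam / 2 with ht
  set M := √(gam * max gam a) * lam with hMdef
  set q := √2 / η with hq
  have hM0 : 0 < M := by positivity
  have ht0 : 0 ≤ t := by positivity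
  have hq0 : 0 < q := by positivity
  have hq1 : 1 ≤ q := by
    rw [hq, one_le_div hη0]
    exact hη1.trans (Real.one_le_sqrt.2 one_le_two)
  have htM : 2 * t ≤ M := by
    have : √(a * min gam a) ≤ √(gam * max gam a) := by
      apply Real.sqrt_le_sqrt
      rcases le_total gam a with h | h
      · rw [min_eq_left h, max_eq_right h, mul_comm]
      · rw [min_eq_right h, max_eq_left h]
        nlinarith
    rw [ht, hMdef]
    nlinarith
  have hgM : gam * lam ≤ M := by
    have : gam ≤ √(gam * max gam a) := by
      apply Real.le_sqrt_of_sq_le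
      rw [sq]
      exact mul_le_mul_of_nonneg_left (le_max_left _ _) hgam.le
    exact mul_le_mul_of_nonneg_right this hlam.le
  have hta : t ≤ a * lam / 2 := by
    have : √(a * min gam a) ≤ a := by
      rw [Real.sqrt_le_left ha.le, sq]
      exact mul_le_mul_of_nonneg_left (min_le_right _ _) ha.le
    rw [ht]
    nlinarith
  have ht2 : t ^ 2 = a * min gam a * lam ^ 2 / 4 := by
    rw [ht, div_pow, mul_pow, Real.sq_sqrt (by positivity)]
    ring
  have hfmax : ∀ k, (SCOPE.fusedCount X theta0 k : ℝ) / n ≤ 1 / a := fun k =>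
    le_trans (div_le_div_of_nonneg_right
      (Nat.cast_le.2 (le_ciSup (Set.finite_range _).bddAbove k)) hn'.le) hmax
  have hfmin : ∀ k, η / s ≤ (SCOPE.fusedCount X theta0 k : ℝ) / n := fun k =>
    hmin.trans (div_le_div_of_nonneg_right
      (Nat.cast_le.2 (ciInf_le (OrderBot.bddBelow _) k)) hn'.le)
  have hmeas := SCOPE.measureReal_exists_lt_abs_sum_le X hX hσ hindep hsub ht0
  set B := {ω | ∃ k, SCOPE.levelCount X k * t
        < |∑ i ∈ Finset.univ.filter (fun i => X i = k), ε i ω|} with hB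
  -- `B` is replaced by a measurable hull of equal measure, as its own measurability is not
  -- available.
  refine ⟨(toMeasurable P B)ᶜ, (measurableSet_toMeasurable P B).compl, ?_, fun ω hω => ?_⟩
  · rw [probReal_compl_eq_one_sub (measurableSet_toMeasurable P B), measureReal_def,
      measure_toMeasurable, ← measureReal_def]
    have e : 2 * Real.exp (-((SCOPE.minLevelCount X : ℝ) * η * s * min gam a * lam ^ 2
          / (8 * (σ : ℝ) ^ 2)) + Real.log K)
        = K * (2 * Real.exp (-(SCOPE.minLevelCount X * t ^ 2 / (2 * (σ : ℝ) ^ 2)))) := by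
      rw [Real.exp_add, Real.exp_log (by linarith), ht2, ha_def]
      have : (SCOPE.minLevelCount X : ℝ) * η * s * min gam (η * s) * lam ^ 2 / (8 * (σ : ℝ) ^ 2)
          = SCOPE.minLevelCount X * (η * s * min gam (η * s) * lam ^ 2 / 4)
            / (2 * (σ : ℝ) ^ 2) := by ring
      rw [this]
      ring
    linarith
  · have hωB : ω ∉ B := fun h => hω (subset_toMeasurable P B h)
    simp only [hB, Set.mem_ofPred_eq, not_exists, not_lt] at hωB
    -- With `r - t = qM`, a group of weight at least `η/s` has `(η/s)(qM)² = 2γ max(γ, a) λ² / a ≥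
    -- 2γλ²`.
    refine SCOPE.estimates_eq_groupMean hn hX mu0 theta0 (fun i => ε i ω) hgam hlam
      (t := t) (r := t + q * M) (by nlinarith [mul_pos hq0 hM0]) hωB (fun k => ?_) (fun k => ?_)
      (fun k => ?_) (fun k l hkl => ?_)
    · calc (SCOPE.fusedCount X theta0 k : ℝ) / n * t ≤ 1 / a * (a * lam / 2) :=
            mul_le_mul (hfmax k) hta ht0 (by positivity)
        _ = lam / 2 := by field_simp
    · calc (SCOPE.fusedCount X theta0 k : ℝ) / n * t ^ 2
          ≤ 1 / a * (a * min gam a * lam ^ 2 / 4) := by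
            rw [← ht2]
            exact mul_le_mul_of_nonneg_right (hfmax k) (sq_nonneg _)
        _ = min gam a * lam ^ 2 / 4 := by field_simp
        _ ≤ gam * lam ^ 2 / 4 := by gcongr; exact min_le_left _ _
    · have e1 : (t + q * M - t) ^ 2 = 2 / η ^ 2 * (gam * max gam a * lam ^ 2) := by
        rw [add_sub_cancel_left, mul_pow, hq, hMdef, div_pow, mul_pow, Real.sq_sqrt hM.le,
          Real.sq_sqrt zero_le_two]
      rw [e1]
      calc 2 * (gam * lam ^ 2) = η / s * (2 / η ^ 2 * (gam * a * lam ^ 2)) := by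
            rw [ha_def]
            field_simp
        _ ≤ η / s * (2 / η ^ 2 * (gam * max gam a * lam ^ 2)) := by
            gcongr
            exact le_max_right _ _
        _ ≤ _ := mul_le_mul_of_nonneg_right (hfmin k) (by positivity)
    · have h1 : SCOPE.minGap theta0 ≤ ((|theta0 k - theta0 l| : ℝ) : EReal) :=
        (iInf_le _ k).trans ((iInf_le _ l).trans (iInf_le _ hkl.ne))
      have h2 := EReal.coe_le_coe_iff.1 (hgap.trans h1)
      rw [abs_sub_comm, abs_of_pos (sub_pos.2 hkl), mul_assoc, ← hMdef] at h2
      -- `γλ + 2(r + 2t) = γλ + 6t + 2qM ≤ 4M + 2qM ≤ 3(1 + q)M`, using `q ≥ 1`.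
      nlinarith [mul_le_mul_of_nonneg_right hq1 hM0.le]
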